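/- Let $(\varphi_e)_{e\in\mathbb N}$ be the standard enumeration of the partial computable functions $\mathbb N\rightharpoonup\mathbb N$, let $\langle\cdot,\cdot\rangle$ be a computable pairing bijection $\mathbb N^2\to\mathbb N$, and let $D_k$ be the finite set with canonical index $k$ (so $k=\sum_{i\in D_k}2^i$). Let $\mathrm{Tot}=\{e:\varphi_e\text{ is total}\}$. For $e\in\mathrm{Tot}$ let $\mathcal F_e$ be the computably finitary argumentation framework with index $e$: its arguments are $a_0,a_1,a_2,\dots$ (pairwise distinct), and $a_n$ attacks $a_m$ iff $n\in D_{\varphi_e(m)}$. A set $S$ of arguments is admissible if no element of $S$ attacks an element of $S$, and every argument that attacks an element of $S$ is attacked by an element of $S$. Define $$\mathrm{Exists}=\{e\in\mathrm{Tot}:\mathcal F_e\text{ has an infinite admissible set}\},$$ $$\mathrm{Cred}=\{\langle e,n\rangle: e\in\mathrm{Tot},\ a_n\text{ belongs to some infinite admissible set of }\mathcal F_e\},$$ $$\mathrm{Skept}=\{\langle e,n\rangle: e\in\mathrm{Tot},\ a_n\text{ belongs to every infinite admissible set of }\mathcal F_e\}.$$ A set $Z\subseteq\mathbb N$ is $\Sigma^0_2$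 if there is a computable relation $R\subseteq\mathbb N^3$ with $x\in Z\iff\exists y\,\forall z\,R(x,y,z)$, and $\Pi^0_2$ if its complement is $\Sigma^0_2$. It is $u$-$\Sigma^0_2$ (respectively $d$-$\Sigma^0_2$) if it is the union (respectively the intersection) of a $\Sigma^0_2$ set and a $\Pi^0_2$ set. For a class $\Gamma$ of subsets of $\mathbb N$ and $X\subseteq\mathbb N$, a set $P\subseteq X$ is $\Gamma$-hard within $X$ if for every $Z\in\Gamma$ there is a total computable function $f:\mathbb N\to X$ such that $x\in Z\iff f(x)\in P$ for all $x\in\mathbb N$. **Theorem.** $\mathrm{Exists}$ is $u$-$\Sigma^0_2$-hard within $\mathrm{Tot}$. Within $\{\langle e,n\rangle: e\in\mathrm{Tot},\ n\in\mathbb N\}$, $\mathrm{Cred}$ is $u$-$\Sigma^0_2$-hard and $\mathrm{Skept}$ is $d$-$\Sigma^0_2$-hard. -/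

import Mathlib

/-- An argumentation framework with set of arguments `A`: the attack relation on `A`;
`F.Attacks a b` means that `a` attacks `b`. -/
structure ArgFramework (A : Type*) where
  Attacks : A → A → Prop

namespace ArgFramework

variable {A : Type*}

/-- `S` is conflict-free: no member of `S` attacks a member of `S`. -/
def ConflictFree (F : ArgFramework A) (S : Set A) : Prop :=
  ∀ a ∈ S, ∀ b ∈ S, ¬ F.Attacks a b

/-- `S` defends `a`: every attacker of `a` is attacked by a member of `S`. -/
def Defends (F : ArgFramework A) (S : Set A) (a : A) : Prop :=
  ∀ b, F.Attacks b a → ∃ c ∈ S, F.Attacks c b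

/-- The characteristic function of `F`. -/
def charFun (F : ArgFramework A) (S : Set A) : Set A :=
  {a | F.Defends S a}

/-- The admissible extensions: conflict-free sets which defend all their members. -/
def ad (F : ArgFramework A) : Set (Set A) :=
  {S | F.ConflictFree S ∧ S ⊆ F.charFun S}

/-- The infinite admissible extensions. -/
def infad (F : ArgFramework A) : Set (Set A) :=
  {S | S ∈ F.ad ∧ S.Infinite}

/-- The enumeration `φ₀, φ₁, …` of all partial computable functions of one variable. -/
def phi (e : ℕ) : ℕ →. ℕ :=
  (Denumerable.ofNat Nat.Partrec.Code e).eval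

/-- The set of indices of total computable functions. -/
def Tot : Set ℕ :=
  {e | ∀ m, (phi e m).Dom}

/-- The finite set with canonical index `k`, that is, the set of positions of the digit 1 in the
binary expansion of `k`. -/
def finsetOfIndex (k : ℕ) : Finset ℕ :=
  k.bitIndices.toFinset

/-- For `e ∈ Tot`, the computably finitary framework with index `e`: its arguments are
`a₀, a₁, …`, with `aₙ` written as `n`, and the attackers of `m` are the members of the finite
set with canonical index `φₑ(m)`. It is only used for `e ∈ Tot`. -/
def ofIndex (e : ℕ) : ArgFramework ℕ where
  Attacks n m := ∃ k ∈ phi e m, n ∈ finsetOfIndex k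

/-- Extension existence for the semantics `σ` on computably finitary frameworks. -/
def ExtExists (σ : ArgFramework ℕ → Set (Set ℕ)) : Set ℕ :=
  {e | e ∈ Tot ∧ ∃ S, S ∈ σ (ofIndex e)}

/-- Credulous acceptance for the semantics `σ` on computably finitary frameworks. -/
def Cred (σ : ArgFramework ℕ → Set (Set ℕ)) : Set ℕ :=
  {x | ∃ e n, x = Nat.pair e n ∧ e ∈ Tot ∧ ∃ S ∈ σ (ofIndex e), n ∈ S}

/-- Skeptical acceptance for the semantics `σ` on computably finitary frameworks. -/
def Skept (σ : ArgFramework ℕ → Set (Set ℕ)) : Set ℕ :=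
  {x | ∃ e n, x = Nat.pair e n ∧ e ∈ Tot ∧ ∀ S ∈ σ (ofIndex e), n ∈ S}

/-- The set `Tot × ℕ`, coded as a set of numbers by the pairing function. -/
def TotPairs : Set ℕ :=
  {x | ∃ e n, x = Nat.pair e n ∧ e ∈ Tot}

end ArgFramework

/-- The class of `Σ⁰₂` sets of numbers. -/
def SigmaZeroTwo : Set (Set ℕ) :=
  {X | ∃ R : ℕ × ℕ × ℕ → Prop, ComputablePred R ∧ ∀ x, x ∈ X ↔ ∃ y, ∀ z, R (x, y, z)}

/-- The class of `Π⁰₂` sets of numbers. -/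
def PiZeroTwo : Set (Set ℕ) :=
  {X | Xᶜ ∈ SigmaZeroTwo}

/-- The class of `u-Σ⁰₂` sets: unions of a `Σ⁰₂` set and a `Π⁰₂` set. -/
def USigmaZeroTwo : Set (Set ℕ) :=
  {Z | ∃ X ∈ SigmaZeroTwo, ∃ Y ∈ PiZeroTwo, Z = X ∪ Y}

/-- The class of `d-Σ⁰₂` sets: intersections of a `Σ⁰₂` set and a `Π⁰₂` set. -/
def DSigmaZeroTwo : Set (Set ℕ) :=
  {Z | ∃ X ∈ SigmaZeroTwo, ∃ Y ∈ PiZeroTwo, Z = X ∩ Y}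

/-- `P` is `Γ`-hard within `X`: every set in `Γ` reduces to `P` by a total computable function
all of whose values lie in `X`. -/
def HardWithin (Γ : Set (Set ℕ)) (X P : Set ℕ) : Prop :=
  ∀ Z ∈ Γ, ∃ f : ℕ → ℕ, Computable f ∧ (∀ x, f x ∈ X) ∧ ∀ x, x ∈ Z ↔ f x ∈ P

/-! Given a `Σ⁰₂` set and a `Π⁰₂` set, one framework tests both memberships of `x`, with at most one
attacker per argument.

For `∃ y, ∀ z, R (x, y, z)`, each `y` gets a chain in which every argument is attacked by its
successor. While the chain is unbroken, its even positions defend one another. From the first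
failure of `R` on, its arguments attack themselves, and since defence propagates along the chain, no
member is acceptable (`chains_forall_of_mem`).

For the `Π⁰₂` set, the even arguments carry a decidable predicate that holds infinitely often
exactly when `x` is in the set (`infinite_firstRefuted_iff`). Where it holds they are unattacked,
elsewhere (`0` aside) they attack themselves. Thus an infinite admissible set exists iff one of the
two tests succeeds (`chains_exists_infad_iff`).

The argument `0` is isolated, so it can be added to or removed from any infinite admissible set. Its
credulous acceptance is therefore equivalent to existence, and its skeptical acceptance to
nonexistence, which turns `u-Σ⁰₂` into `d-Σ⁰₂` by complementation. -/

/-- `boundedAll q n` decides whether `q i` holds for all `i < n`. -/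
def boundedAll (q : ℕ → Bool) (n : ℕ) : Bool :=
  Nat.rec true (fun i b => b && q i) n

theorem boundedAll_eq_true_iff (q : ℕ → Bool) (n : ℕ) :
    boundedAll q n = true ↔ ∀ i < n, q i = true := by
  induction n with
  | zero => simp [boundedAll]
  | succ n ih =>
    have h : boundedAll q (n + 1) = (boundedAll q n && q n) := rfl
    rw [h, Bool.and_eq_true, ih, Nat.forall_lt_succ_right]

theorem Computable.boundedAll {α : Type*} [Primcodable α] {q : α → ℕ → Bool} {f : α → ℕ}
    (hq : Computable₂ q) (hf : Computable f) :
    Computable fun a => boundedAll (q a) (f a) := by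
  refine Computable.nat_rec (h := fun a p => p.2 && q a p.1) hf (Computable.const true) ?_
  exact Primrec.and.to_comp.comp (Computable.snd.comp Computable.snd)
    (hq.comp Computable.fst (Computable.fst.comp Computable.snd))

theorem Computable.two_pow : Computable fun n : ℕ => 2 ^ n := by
  have h : Computable fun n : ℕ => Nat.rec (motive := fun _ => ℕ) 1 (fun _ b => b * 2) n :=
    Computable.nat_rec (f := fun n : ℕ => n) (g := fun _ => 1) (h := fun _ p => p.2 * 2)
      Computable.id (Computable.const 1)
      (Primrec.nat_mul.to_comp.comp (Computable.snd.comp Computable.snd) (Computable.const 2))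
  refine h.of_eq fun n => ?_
  induction n with
  | zero => rfl
  | succ n ih => rw [pow_succ, ← ih]

/-! ### `Π⁰₂` conditions as infinitude of a decidable set -/

/-- Least stage `z` at which every `y < n` has a witness below `z` refuting `r`. -/
def firstRefuted (r : ℕ → ℕ → Bool) (n z : ℕ) : Bool :=
  boundedAll (fun y => !boundedAll (r y) z) n &&
    boundedAll (fun w => !boundedAll (fun y => !boundedAll (r y) w) n) z

theorem firstRefuted_eq_true_iff (r : ℕ → ℕ → Bool) (n z : ℕ) :
    firstRefuted r n z = true ↔
      (∀ y < n, ∃ w < z, r y w = false) ∧ ∀ v < z, ¬ ∀ y < n, ∃ w < v, r y w = false := by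
  have key : ∀ v, boundedAll (fun y => !boundedAll (r y) v) n = true ↔
      ∀ y < n, ∃ w < v, r y w = false := by
    intro v
    simp only [boundedAll_eq_true_iff, Bool.not_eq_true', ← Bool.not_eq_true, not_forall,
      exists_prop]
  simp only [firstRefuted, Bool.and_eq_true, key]
  rw [boundedAll_eq_true_iff]
  simp only [Bool.not_eq_true', ← Bool.not_eq_true, key]

/-- A `Π⁰₂` condition holds iff infinitely many numbers are first stages of refutation. -/
theorem infinite_firstRefuted_iff (r : ℕ → ℕ → Bool) :
    {k : ℕ | firstRefuted r k.unpair.1 k.unpair.2 = true}.Infinite ↔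
      ∀ y, ∃ z, r y z = false := by
  simp only [firstRefuted_eq_true_iff]
  constructor
  · intro h
    by_contra! hc
    obtain ⟨y₀, hy₀⟩ := hc
    -- If `y₀` is never refuted, no `n > y₀` has a stage. Each remaining `n` has at most one first
    -- stage, so projecting to `n` is injective with finite image.
    refine h (Set.Finite.of_finite_image (f := fun k : ℕ => k.unpair.1)
      ((Set.finite_Iic y₀).subset ?_) ?_)
    · rintro _ ⟨k, ⟨hk, -⟩, rfl⟩
      by_contra hlt
      obtain ⟨w, -, hw⟩ := hk y₀ (not_le.mp hlt)
      exact hy₀ w hw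
    · rintro k ⟨hk, hk'⟩ l ⟨hl, hl'⟩ (hkl : k.unpair.1 = l.unpair.1)
      rw [hkl] at hk hk'
      have h2 : k.unpair.2 = l.unpair.2 :=
        le_antisymm (not_lt.mp fun hlt => hk' _ hlt hl) (not_lt.mp fun hlt => hl' _ hlt hk)
      rw [← Nat.pair_unpair k, ← Nat.pair_unpair l, hkl, h2]
  · intro h
    have hstage : ∀ n, ∃ z, ∀ y < n, ∃ w < z, r y w = false := by
      intro n
      induction n with
      | zero => exact ⟨0, by simp⟩
      | succ n ih =>
        obtain ⟨z, hz⟩ := ih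
        obtain ⟨w, hw⟩ := h n
        -- Stages bound witnesses strictly, hence `w + 1`.
        refine ⟨max z (w + 1), fun y hy => ?_⟩
        rcases Nat.lt_succ_iff_lt_or_eq.mp hy with hy | rfl
        · obtain ⟨v, hv, hv'⟩ := hz y hy
          exact ⟨v, lt_max_of_lt_left hv, hv'⟩
        · exact ⟨w, lt_max_of_lt_right w.lt_succ_self, hw⟩
    classical
    refine Set.infinite_of_injective_forall_mem (f := fun n => Nat.pair n (Nat.find (hstage n)))
      (fun m n hmn => (Nat.pair_eq_pair.mp hmn).1) fun n => ?_
    simp only [Set.mem_ofPred_eq, Nat.unpair_pair]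
    exact ⟨Nat.find_spec (hstage n), fun v hv => Nat.find_min (hstage n) hv⟩

/-! ### The framework of chains and unattacked arguments -/

namespace ArgFramework

/-- Canonical index of the set of attackers of `m`. An even argument `2k` is unattacked if `k = 0`
or `p k`, and otherwise attacks itself. An odd argument `2⟨y, z⟩ + 1` is attacked by
`2⟨y, z + 1⟩ + 1` alone as long as `r y` does not fail up to `z`, and afterwards by itself alone. -/
def attackersIndex (p : ℕ → Bool) (r : ℕ → ℕ → Bool) (m : ℕ) : ℕ :=
  bif m.bodd then
    bif boundedAll (r m.div2.unpair.1) (m.div2.unpair.2 + 1) then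
      2 ^ (2 * Nat.pair m.div2.unpair.1 (m.div2.unpair.2 + 1) + 1)
    else 2 ^ m
  else bif m.div2 == 0 || p m.div2 then 0 else 2 ^ m

theorem finsetOfIndex_zero : finsetOfIndex 0 = ∅ := by
  simp [finsetOfIndex]

theorem finsetOfIndex_two_pow (n : ℕ) : finsetOfIndex (2 ^ n) = {n} := by
  simp [finsetOfIndex]

/-- The framework in which the attackers of `m` have canonical index `attackersIndex p r m`. -/
def chains (p : ℕ → Bool) (r : ℕ → ℕ → Bool) : ArgFramework ℕ where
  Attacks n m := n ∈ finsetOfIndex (attackersIndex p r m)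

section chains

variable {p : ℕ → Bool} {r : ℕ → ℕ → Bool}

theorem chains_attacks_even {n k : ℕ} :
    (chains p r).Attacks n (2 * k) ↔ k ≠ 0 ∧ p k = false ∧ n = 2 * k := by
  have h1 : (2 * k).bodd = false := by simp
  have h2 : (2 * k).div2 = k := by simp [Nat.div2_val]
  simp only [chains, attackersIndex, h1, h2, cond_false]
  by_cases hk : k = 0
  · simp [hk, finsetOfIndex_zero]
  · have hk' : (k == 0) = false := by simpa using hk
    cases hp : p k <;> simp [hk, hk', finsetOfIndex_zero, finsetOfIndex_two_pow]

theorem chains_attacks_odd {n y z : ℕ} :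
    (chains p r).Attacks n (2 * Nat.pair y z + 1) ↔
      ((∀ w ≤ z, r y w = true) ∧ n = 2 * Nat.pair y (z + 1) + 1) ∨
      ((¬ ∀ w ≤ z, r y w = true) ∧ n = 2 * Nat.pair y z + 1) := by
  have h1 : (2 * Nat.pair y z + 1).bodd = true := by simp
  have h2 : (2 * Nat.pair y z + 1).div2 = Nat.pair y z := by
    rw [Nat.div2_val]; omega
  have h3 : boundedAll (r y) (z + 1) = true ↔ ∀ w ≤ z, r y w = true := by
    simp only [boundedAll_eq_true_iff, Nat.lt_succ_iff]
  simp only [chains, attackersIndex, h1, h2, cond_true, Nat.unpair_pair, ← h3]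
  cases boundedAll (r y) (z + 1) <;> simp [finsetOfIndex_two_pow]

theorem chains_not_attacks_zero (n : ℕ) : ¬ (chains p r).Attacks n 0 := fun h =>
  (chains_attacks_even (k := 0).mp h).1 rfl

/-- A member of a chain lies in an admissible set only if its chain never breaks. -/
theorem chains_forall_of_mem {S : Set ℕ} (hS : S ∈ (chains p r).ad) {y z : ℕ}
    (h : 2 * Nat.pair y z + 1 ∈ S) (w : ℕ) : r y w = true := by
  obtain ⟨hcf, hdef⟩ := hS
  have good : ∀ z, 2 * Nat.pair y z + 1 ∈ S → ∀ w ≤ z, r y w = true := by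
    intro z hz
    by_contra hn
    exact hcf _ hz _ hz (chains_attacks_odd.mpr (Or.inr ⟨hn, rfl⟩))
  have step : ∀ z, 2 * Nat.pair y z + 1 ∈ S → 2 * Nat.pair y (z + 2) + 1 ∈ S := by
    intro z hz
    have hatt := chains_attacks_odd (p := p).mpr (Or.inl ⟨good z hz, rfl⟩)
    obtain ⟨c, hc, hc'⟩ := hdef hz _ hatt
    -- The attacker at `z + 1` is countered either by `z + 2` or by itself. In the latter case it
    -- would lie in `S` and attack the member at `z`.
    rcases chains_attacks_odd.mp hc' with ⟨-, rfl⟩ | ⟨-, rfl⟩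
    · exact hc
    · exact absurd hatt (hcf _ hc _ hz)
  have all : ∀ i, 2 * Nat.pair y (z + 2 * i) + 1 ∈ S := by
    intro i
    induction i with
    | zero => exact h
    | succ i ih => exact step _ ih
  -- Position `z + 2 * w` is at least `w`.
  exact good _ (all w) w (by omega)

/-- An unbroken chain yields an infinite admissible set. -/
theorem chains_exists_infad_of_forall {y : ℕ} (h : ∀ z, r y z = true) :
    ∃ S, S ∈ (chains p r).infad := by
  have hatt : ∀ n z, (chains p r).Attacks n (2 * Nat.pair y z + 1) ↔
      n = 2 * Nat.pair y (z + 1) + 1 := by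
    intro n z
    rw [chains_attacks_odd]
    have : ∀ w ≤ z, r y w = true := fun w _ => h w
    tauto
  -- Even positions of the chain: the only attacker of `2 * i` sits at `2 * i + 1`, and is attacked
  -- from `2 * (i + 1)`.
  refine ⟨Set.range fun i => 2 * Nat.pair y (2 * i) + 1, ⟨?_, ?_⟩, ?_⟩
  · rintro _ ⟨i, rfl⟩ _ ⟨j, rfl⟩ hij
    have h1 : Nat.pair y (2 * i) = Nat.pair y (2 * j + 1) := by
      have : 2 * Nat.pair y (2 * i) + 1 = 2 * Nat.pair y (2 * j + 1) + 1 := (hatt _ _).mp hij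
      omega
    have := (Nat.pair_eq_pair.mp h1).2
    omega
  · rintro _ ⟨i, rfl⟩ b hb
    rw [(hatt _ _).mp hb]
    exact ⟨_, ⟨i + 1, rfl⟩, (hatt _ _).mpr rfl⟩
  · refine Set.infinite_range_of_injective fun i j hij => ?_
    have h1 : Nat.pair y (2 * i) = Nat.pair y (2 * j) := by
      have : 2 * Nat.pair y (2 * i) + 1 = 2 * Nat.pair y (2 * j) + 1 := hij
      omega
    have := (Nat.pair_eq_pair.mp h1).2
    omega

/-- Infinitely many unattacked arguments form an infinite admissible set. -/
theorem chains_exists_infad_of_infinite (h : {k | p k = true}.Infinite) :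
    ∃ S, S ∈ (chains p r).infad := by
  have hatt : ∀ n k, p k = true → ¬ (chains p r).Attacks n (2 * k) := by
    intro n k hk hn
    have := (chains_attacks_even.mp hn).2.1
    simp [hk] at this
  refine ⟨(fun k => 2 * k) '' {k | p k = true}, ⟨?_, ?_⟩, ?_⟩
  · rintro a - _ ⟨k, hk, rfl⟩ hab
    exact hatt _ _ hk hab
  · rintro _ ⟨k, hk, rfl⟩ b hb
    exact absurd hb (hatt _ _ hk)
  · exact h.image (mul_right_injective₀ two_ne_zero).injOn

/-- A single odd member already forces an unbroken chain. Without odd members, the set consists of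
even arguments that do not attack themselves, and only `0` can be among these without satisfying
`p`. -/
theorem chains_exists_infad_iff :
    (∃ S, S ∈ (chains p r).infad) ↔ (∃ y, ∀ z, r y z = true) ∨ {k | p k = true}.Infinite := by
  constructor
  · rintro ⟨S, hS, hinf⟩
    by_cases hodd : ∃ y z, 2 * Nat.pair y z + 1 ∈ S
    · obtain ⟨y, z, hyz⟩ := hodd
      exact Or.inl ⟨y, chains_forall_of_mem hS hyz⟩
    -- The `insert 0` is needed because the argument `0` is unattacked even if `p 0` fails.
    · refine Or.inr fun hfin => hinf (((hfin.insert 0).image fun k => 2 * k).subset ?_)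
      intro m hm
      rcases Nat.even_or_odd' m with ⟨k, rfl | rfl⟩
      · refine ⟨k, ?_, rfl⟩
        by_contra hk
        simp only [Set.mem_insert_iff, Set.mem_ofPred_eq, not_or, Bool.not_eq_true] at hk
        exact hS.1 _ hm _ hm (chains_attacks_even.mpr ⟨hk.1, hk.2, rfl⟩)
      · exact absurd ⟨k.unpair.1, k.unpair.2, by rwa [Nat.pair_unpair]⟩ hodd
  · rintro (⟨y, hy⟩ | h)
    · exact chains_exists_infad_of_forall hy
    · exact chains_exists_infad_of_infinite h

/-- Attackers are odd or are self-attackers `2 * k` with `k ≠ 0`. With `chains_not_attacks_zero`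
this isolates `0`, the argument queried for acceptance. -/
theorem chains_not_attacks_of_zero (m : ℕ) : ¬ (chains p r).Attacks 0 m := by
  intro h
  rcases Nat.even_or_odd' m with ⟨k, rfl | rfl⟩
  · obtain ⟨hk, -, h0⟩ := chains_attacks_even.mp h
    omega
  · rw [← Nat.pair_unpair k] at h
    rcases chains_attacks_odd.mp h with ⟨-, h0⟩ | ⟨-, h0⟩ <;> omega

end chains

/-! ### Acceptance of an isolated argument -/

section isolated

variable {A : Type*} {F : ArgFramework A} {a : A} {S : Set A}

/-- An argument without attackers which attacks nothing may be added to an infinite admissible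
set. -/
theorem insert_mem_infad (h₁ : ∀ b, ¬ F.Attacks b a) (h₂ : ∀ b, ¬ F.Attacks a b)
    (hS : S ∈ F.infad) : insert a S ∈ F.infad := by
  obtain ⟨⟨hcf, hdef⟩, hinf⟩ := hS
  refine ⟨⟨?_, ?_⟩, hinf.mono (Set.subset_insert a S)⟩
  · rintro b (rfl | hb) c (rfl | hc)
    · exact h₁ _
    · exact h₂ _
    · exact h₁ _
    · exact hcf b hb c hc
  · rintro b (rfl | hb) c hc
    · exact absurd hc (h₁ c)
    · obtain ⟨d, hd, hdc⟩ := hdef hb c hc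
      exact ⟨d, Set.mem_insert_of_mem a hd, hdc⟩

/-- An argument which attacks nothing may be removed from an infinite admissible set. -/
theorem diff_singleton_mem_infad (h₂ : ∀ b, ¬ F.Attacks a b) (hS : S ∈ F.infad) :
    S \ {a} ∈ F.infad := by
  obtain ⟨⟨hcf, hdef⟩, hinf⟩ := hS
  refine ⟨⟨fun b hb c hc => hcf b hb.1 c hc.1, ?_⟩, hinf.sdiff (Set.finite_singleton a)⟩
  intro b hb c hc
  obtain ⟨d, hd, hdc⟩ := hdef hb.1 c hc
  refine ⟨d, ⟨hd, ?_⟩, hdc⟩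
  rintro rfl
  exact h₂ c hdc

theorem exists_mem_infad_iff (h₁ : ∀ b, ¬ F.Attacks b a) (h₂ : ∀ b, ¬ F.Attacks a b) :
    (∃ S ∈ F.infad, a ∈ S) ↔ ∃ S, S ∈ F.infad :=
  ⟨fun ⟨S, hS, _⟩ => ⟨S, hS⟩,
    fun ⟨_, hS⟩ => ⟨_, insert_mem_infad h₁ h₂ hS, Set.mem_insert _ _⟩⟩

/-- Deleting `a` from an infinite admissible set leaves one that omits it, so skeptical acceptance
can only hold vacuously. -/
theorem forall_mem_infad_iff (h₂ : ∀ b, ¬ F.Attacks a b) :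
    (∀ S ∈ F.infad, a ∈ S) ↔ ¬ ∃ S, S ∈ F.infad :=
  ⟨fun h ⟨_, hS⟩ => (h _ (diff_singleton_mem_infad h₂ hS)).2 rfl,
    fun h S hS => absurd ⟨S, hS⟩ h⟩

end isolated

/-! ### Computability of the reduction -/

/-- Parametrization: a computable function of two variables has computable indices for its
sections. -/
theorem exists_computable_index {g : ℕ → ℕ → ℕ} (hg : Computable₂ g) :
    ∃ f : ℕ → ℕ, Computable f ∧ ∀ x m, phi (f x) m = Part.some (g x m) := by
  have hpair : Computable fun n : ℕ => g n.unpair.1 n.unpair.2 :=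
    hg.comp (Computable.fst.comp Computable.unpair) (Computable.snd.comp Computable.unpair)
  obtain ⟨c, hc⟩ := Nat.Partrec.Code.exists_code.mp (Partrec.nat_iff.mp hpair.partrec)
  refine ⟨fun x => Encodable.encode (c.curry x), ?_, fun x m => ?_⟩
  · exact (Primrec.encode.comp
      (Nat.Partrec.Code.primrec₂_curry.comp (Primrec.const c) Primrec.id)).to_comp
  · simp [phi, Nat.Partrec.Code.eval_curry, hc]

theorem computable_attackersIndex {p : ℕ → ℕ → Bool} {r : ℕ → ℕ → ℕ → Bool}
    (hp : Computable₂ p) (hr : Computable fun t : ℕ × ℕ × ℕ => r t.1 t.2.1 t.2.2) :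
    Computable₂ fun x m => attackersIndex (p x) (r x) m := by
  have hm : Computable fun a : ℕ × ℕ => a.2 := Computable.snd
  have hd : Computable fun a : ℕ × ℕ => a.2.div2 := Computable.nat_div2.comp hm
  have hu : Computable fun a : ℕ × ℕ => a.2.div2.unpair := Computable.unpair.comp hd
  have hy := Computable.fst.comp hu
  have hz := Computable.succ.comp (Computable.snd.comp hu)
  have hself := Computable.two_pow.comp hm
  have hall : Computable fun a : ℕ × ℕ =>
      boundedAll (r a.1 a.2.div2.unpair.1) (a.2.div2.unpair.2 + 1) := by
    refine Computable.boundedAll (q := fun a : ℕ × ℕ => r a.1 a.2.div2.unpair.1) ?_ hz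
    have harg : Computable fun b : (ℕ × ℕ) × ℕ => (b.1.1, b.1.2.div2.unpair.1, b.2) :=
      (Computable.fst.comp Computable.fst).pair ((hy.comp Computable.fst).pair Computable.snd)
    have hcomp := hr.comp harg
    exact hcomp
  have hnext : Computable fun a : ℕ × ℕ =>
      2 ^ (2 * Nat.pair a.2.div2.unpair.1 (a.2.div2.unpair.2 + 1) + 1) :=
    Computable.two_pow.comp (Computable.succ.comp
      (Primrec.nat_mul.to_comp.comp (Computable.const 2) (Primrec₂.natPair.to_comp.comp hy hz)))
  have hzero : Computable fun a : ℕ × ℕ => (a.2.div2 == 0) :=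
    Primrec.beq.to_comp.comp hd (Computable.const 0)
  exact Computable.cond (Computable.nat_bodd.comp hm) (Computable.cond hall hnext hself)
    (Computable.cond (Primrec.or.to_comp.comp hzero (hp.comp Computable.fst hd))
      (Computable.const 0) hself)

theorem computable_firstRefuted {r : ℕ → ℕ → ℕ → Bool}
    (hr : Computable fun t : ℕ × ℕ × ℕ => r t.1 t.2.1 t.2.2) :
    Computable₂ fun x k => firstRefuted (r x) (Nat.unpair k).1 (Nat.unpair k).2 := by
  have hstage : Computable₂ fun (a : ℕ × ℕ) (v : ℕ) =>
      boundedAll (fun y => !boundedAll (r a.1 y) v) a.2.unpair.1 := by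
    refine Computable.boundedAll (α := (ℕ × ℕ) × ℕ)
      (q := fun b y => !boundedAll (r b.1.1 y) b.2) ?_
      (Computable.fst.comp (Computable.unpair.comp (Computable.snd.comp Computable.fst)))
    refine Primrec.not.to_comp.comp (Computable.boundedAll (α := ((ℕ × ℕ) × ℕ) × ℕ)
      (q := fun b w => r b.1.1.1 b.2 w) ?_ (Computable.snd.comp Computable.fst))
    have harg : Computable fun b : (((ℕ × ℕ) × ℕ) × ℕ) × ℕ => (b.1.1.1.1, b.1.2, b.2) :=
      (Computable.fst.comp (Computable.fst.comp (Computable.fst.comp Computable.fst))).pair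
        ((Computable.snd.comp Computable.fst).pair Computable.snd)
    have hcomp := hr.comp harg
    exact hcomp
  have hz : Computable fun a : ℕ × ℕ => a.2.unpair.2 :=
    Computable.snd.comp (Computable.unpair.comp Computable.snd)
  exact Primrec.and.to_comp.comp (hstage.comp Computable.id hz)
    (Computable.boundedAll (Primrec.not.to_comp.comp hstage) hz)

/-- Every `u-Σ⁰₂` set reduces to the existence of an infinite admissible set, by frameworks in which
`0` neither attacks nor is attacked. -/
theorem exists_reduction_infad {Z : Set ℕ} (hZ : Z ∈ USigmaZeroTwo) :
    ∃ f : ℕ → ℕ, Computable f ∧ (∀ x, f x ∈ Tot) ∧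
      (∀ x, x ∈ Z ↔ ∃ S, S ∈ (ofIndex (f x)).infad) ∧
      ∀ x n, ¬ (ofIndex (f x)).Attacks n 0 ∧ ¬ (ofIndex (f x)).Attacks 0 n := by
  obtain ⟨X, ⟨R, ⟨_, hR⟩, hX⟩, Y, ⟨Q, ⟨_, hQ⟩, hY⟩, rfl⟩ := hZ
  -- The chains follow `R`, which defines `X`. The even arguments follow the refutations of `Q`,
  -- which defines the complement of `Y`.
  obtain ⟨f, hf, hphi⟩ := exists_computable_index (computable_attackersIndex
    (r := fun x y z => decide (R (x, y, z)))
    (computable_firstRefuted (r := fun x y z => decide (Q (x, y, z))) hQ) hR)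
  have hF : ∀ x, ofIndex (f x) = chains
      (fun k => firstRefuted (fun y z => decide (Q (x, y, z))) k.unpair.1 k.unpair.2)
      (fun y z => decide (R (x, y, z))) := by
    intro x
    simp [ofIndex, chains, hphi]
  refine ⟨f, hf, fun x m => by simp [hphi], fun x => ?_, fun x n => ?_⟩
  · have hYx : x ∈ Y ↔ ¬ ∃ y, ∀ z, Q (x, y, z) := by
      rw [← hY x, Set.mem_compl_iff, not_not]
    rw [hF, chains_exists_infad_iff, infinite_firstRefuted_iff, Set.mem_union, hX, hYx]
    simp
  · rw [hF]
    exact ⟨chains_not_attacks_zero n, chains_not_attacks_of_zero n⟩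

end ArgFramework

/-! ### The three hardness results -/

theorem compl_mem_USigmaZeroTwo {Z : Set ℕ} (hZ : Z ∈ DSigmaZeroTwo) : Zᶜ ∈ USigmaZeroTwo := by
  obtain ⟨X, hX, Y, hY, rfl⟩ := hZ
  refine ⟨Yᶜ, hY, Xᶜ, ?_, by rw [Set.compl_inter, Set.union_comm]⟩
  simpa [PiZeroTwo] using hX

theorem mainTheorem4 :
    HardWithin USigmaZeroTwo ArgFramework.Tot (ArgFramework.ExtExists ArgFramework.infad) ∧
    HardWithin USigmaZeroTwo ArgFramework.TotPairs (ArgFramework.Cred ArgFramework.infad) ∧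
    HardWithin DSigmaZeroTwo ArgFramework.TotPairs (ArgFramework.Skept ArgFramework.infad) := by
  refine ⟨fun Z hZ => ?_, fun Z hZ => ?_, fun Z hZ => ?_⟩
  · obtain ⟨f, hf, htot, hiff, -⟩ := ArgFramework.exists_reduction_infad hZ
    refine ⟨f, hf, htot, fun x => (hiff x).trans ?_⟩
    exact ⟨fun h => ⟨htot x, h⟩, fun h => h.2⟩
  · obtain ⟨f, hf, htot, hiff, h0⟩ := ArgFramework.exists_reduction_infad hZ
    refine ⟨fun x => Nat.pair (f x) 0, Primrec₂.natPair.to_comp.comp hf (Computable.const 0),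
      fun x => ⟨f x, 0, rfl, htot x⟩, fun x => (hiff x).trans ?_⟩
    rw [← ArgFramework.exists_mem_infad_iff (fun n => (h0 x n).1) (fun n => (h0 x n).2)]
    refine ⟨fun h => ⟨f x, 0, rfl, htot x, h⟩, ?_⟩
    rintro ⟨e, n, hen, -, h⟩
    obtain ⟨rfl, rfl⟩ := Nat.pair_eq_pair.mp hen
    exact h
  · obtain ⟨f, hf, htot, hiff, h0⟩ :=
      ArgFramework.exists_reduction_infad (compl_mem_USigmaZeroTwo hZ)
    refine ⟨fun x => Nat.pair (f x) 0, Primrec₂.natPair.to_comp.comp hf (Computable.const 0),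
      fun x => ⟨f x, 0, rfl, htot x⟩, fun x => ?_⟩
    -- The reduction `f` was built for `Zᶜ`, so `x ∈ Z` means that no infinite admissible set
    -- exists, which is skeptical acceptance of `0`.
    rw [← not_iff_not, ← Set.mem_compl_iff, hiff x, iff_not_comm,
      ← ArgFramework.forall_mem_infad_iff fun n => (h0 x n).2]
    constructor
    · rintro ⟨e, n, hen, -, h⟩
      obtain ⟨rfl, rfl⟩ := Nat.pair_eq_pair.mp hen
      exact h
    · exact fun h => ⟨f x, 0, rfl, htot x, h⟩
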